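/- Consider the following four existence assertions. In each of them there are finitely many players $i=1,\dots,p$; player $i$ has a compact, convex, non-empty strategy set $C_i$ in a real Banach space $E_i$ (with its norm topology) and a payoff function $\theta_i:C\to\mathbb{R}$, where $C=\prod_{j=1}^p C_j$; and $\theta_i$ is quasi-concave in $x_i$, i.e. for all $x\in C$ and $\lambda\in\mathbb{R}$ the set $\{t\in C_i:\theta_i(t,x_{-i})\ge\lambda\}$ is convex. Here $x_{-i}$ denotes the strategies of the players other than $i$ and $C^{-i}=\prod_{j\neq i}C_j$. In (AD) and (MS$'$) each player also has a correspondence $K_i$ assigning to each $x_{-i}\in C^{-i}$ a subset $K_i(x_{-i})\subset C_i$; it is lower and upper hemicontinuous with convex, closed and non-empty values. A real function $f$ on a topological space is pseudo-continuous if, whenever $f(x)<f(y)$, one has $f(x')<f(y)$ for all $x'$ in some neighbourhood of $x$ and $f(y')>f(x)$ for all $y'$ in some neighbourhood of $y$. A Nash equilibrium is an $\hat x\in C$ such that, for every $i$, $\hat x_i$ maximizes $\theta_i(\cdot,\hat x_{-i})$ over $C_i$. A generalized Nash equilibrium is an $\hat x\in C$ such that, for every $i$, $\hat x_i\in K_i(\hat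 x_{-i})$ and $\hat x_i$ maximizes $\theta_i(\cdot,\hat x_{-i})$ over $K_i(\hat x_{-i})$. - (D) (Debreu) If all $\theta_i$ are continuous, there is a Nash equilibrium. - (AD) (Arrow–Debreu) If all $\theta_i$ are continuous, there is a generalized Nash equilibrium. - (MS) (Morgan–Scalzo, Nash games) If all $\theta_i$ are pseudo-continuous, there is a Nash equilibrium. - (MS$'$) (Morgan–Scalzo, generalized Nash games) If all $\theta_i$ are pseudo-continuous, there is a generalized Nash equilibrium. Each assertion is quantified over all numbers of players, all real Banach spaces $E_i$ and all such games. **Theorem.** (D) implies (AD). Consequently (D), (AD), (MS) and (MS$'$) are equivalent. -/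

import Mathlib

open Topology

universe u

section PseudoContinuity

variable {X : Type*} [TopologicalSpace X]

/-- Upper pseudo-continuity of a real-valued function: whenever `f x < f y`, the inequality
`f x' < f y` holds for all `x'` in a neighbourhood of `x`. -/
def UpperPseudoContinuous (f : X → ℝ) : Prop :=
  ∀ x y : X, f x < f y → ∀ᶠ x' in 𝓝 x, f x' < f y

/-- Lower pseudo-continuity of `f` is upper pseudo-continuity of `-f`. -/
def LowerPseudoContinuous (f : X → ℝ) : Prop :=
  UpperPseudoContinuous (fun x => - f x)

/-- A function is pseudo-continuous if it is both upper and lower pseudo-continuous. -/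
def PseudoContinuous (f : X → ℝ) : Prop :=
  UpperPseudoContinuous f ∧ LowerPseudoContinuous f

end PseudoContinuity

/-- A Nash game with `p` players, in which the `i`-th player chooses a strategy in a subset `C i`
of the space `E i` and has the payoff function `θ i`, a real function on the product of all the
strategy sets. -/
structure NashGame {p : ℕ} (E : Fin p → Type u) where
  C : (i : Fin p) → Set (E i)
  θ : Fin p → ((j : Fin p) → C j) → ℝ

namespace NashGame

variable {p : ℕ} {E : Fin p → Type u}

/-- The total strategy vectors, i.e. the points of the product of the strategy sets. -/
abbrev Profile (G : NashGame E) : Type u := (j : Fin p) → G.C j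

/-- The strategy vectors of the rivals of the `i`-th player. -/
abbrev RivalProfile (G : NashGame E) (i : Fin p) : Type u := (j : {j : Fin p // j ≠ i}) → G.C j

/-- The rivals' part `x_{-i}` of a total strategy vector `x`. -/
def rivals (G : NashGame E) (i : Fin p) (x : G.Profile) : G.RivalProfile i := fun j => x j

/-- `x` is a Nash equilibrium: for each `i`, the strategy `x i` maximizes
`t ↦ θ i (t, x_{-i})` over `C i`. -/
def IsNashEquilibrium (G : NashGame E) (x : G.Profile) : Prop :=
  ∀ i, ∀ t : G.C i, G.θ i (Function.update x i t) ≤ G.θ i x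

/-- All the strategy sets are compact, convex and non-empty. -/
def HasAdmissibleStrategySets [∀ i, NormedAddCommGroup (E i)] [∀ i, NormedSpace ℝ (E i)]
    (G : NashGame E) : Prop :=
  ∀ i, IsCompact (G.C i) ∧ Convex ℝ (G.C i) ∧ (G.C i).Nonempty

/-- The payoff of the `i`-th player is quasi-concave in the player's own variable: for all fixed
strategies of the rivals, all upper level sets of `t ↦ θ i (t, x_{-i})` on `C i` are convex.
(The `i`-th entry of `x` plays no role.) -/
def QuasiConcaveInOwnVariable [∀ i, AddCommGroup (E i)] [∀ i, Module ℝ (E i)]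
    (G : NashGame E) (i : Fin p) : Prop :=
  ∀ (x : G.Profile) (r : ℝ),
    Convex ℝ {t : E i | ∃ ht : t ∈ G.C i, r ≤ G.θ i (Function.update x i ⟨t, ht⟩)}

end NashGame

/-- A generalized Nash game: a Nash game together with, for each player `i`, a correspondence
`K i` that assigns to each strategy vector of the rivals a subset of `C i`. -/
structure GeneralizedNashGame {p : ℕ} (E : Fin p → Type u) extends NashGame E where
  K : (i : Fin p) → toNashGame.RivalProfile i → Set (C i)

namespace GeneralizedNashGame

variable {p : ℕ} {E : Fin p → Type u}

/-- `x` is a generalized Nash equilibrium: for each `i`, the strategy `x i` belongs to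
`K i x_{-i}` and maximizes `t ↦ θ i (t, x_{-i})` over `K i x_{-i}`. -/
def IsGeneralizedNashEquilibrium (G : GeneralizedNashGame E) (x : G.Profile) : Prop :=
  ∀ i, x i ∈ G.K i (G.rivals i x) ∧
    ∀ t ∈ G.K i (G.rivals i x), G.θ i (Function.update x i t) ≤ G.θ i x

/-- The constraint correspondence of the `i`-th player is lower and upper hemicontinuous, with
convex, closed and non-empty values. -/
def HasAdmissibleConstraint [∀ i, NormedAddCommGroup (E i)] [∀ i, NormedSpace ℝ (E i)]
    (G : GeneralizedNashGame E) (i : Fin p) : Prop :=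
  LowerHemicontinuous (G.K i) ∧ UpperHemicontinuous (G.K i) ∧
    ∀ y : G.RivalProfile i,
      Convex ℝ (Subtype.val '' G.K i y) ∧ IsClosed (G.K i y) ∧ (G.K i y).Nonempty

end GeneralizedNashGame

/-- The assertion of Debreu's theorem on Banach spaces: every Nash game with finitely many players
and with compact, convex, non-empty strategy sets in real Banach spaces, whose payoffs are
continuous and quasi-concave in the player's own variable, has a Nash equilibrium. -/
def DebreuTheorem : Prop :=
  ∀ (p : ℕ) (E : Fin p → Type u) [∀ i, NormedAddCommGroup (E i)] [∀ i, NormedSpace ℝ (E i)]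
    [∀ i, CompleteSpace (E i)] (G : NashGame E),
    G.HasAdmissibleStrategySets →
    (∀ i, Continuous (G.θ i) ∧ G.QuasiConcaveInOwnVariable i) →
    ∃ x : G.Profile, G.IsNashEquilibrium x

/-- The assertion of the Morgan–Scalzo theorem for Nash games on Banach spaces: as in Debreu's
theorem, with pseudo-continuous payoffs. -/
def MorganScalzoNashTheorem : Prop :=
  ∀ (p : ℕ) (E : Fin p → Type u) [∀ i, NormedAddCommGroup (E i)] [∀ i, NormedSpace ℝ (E i)]
    [∀ i, CompleteSpace (E i)] (G : NashGame E),
    G.HasAdmissibleStrategySets →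
    (∀ i, PseudoContinuous (G.θ i) ∧ G.QuasiConcaveInOwnVariable i) →
    ∃ x : G.Profile, G.IsNashEquilibrium x

/-- The assertion of the Arrow–Debreu theorem on Banach spaces: every generalized Nash game with
finitely many players and with compact, convex, non-empty strategy sets in real Banach spaces,
whose payoffs are continuous and quasi-concave in the player's own variable, and whose constraint
correspondences are lower and upper hemicontinuous with convex, closed and non-empty values, has a
generalized Nash equilibrium. -/
def ArrowDebreuTheorem : Prop :=
  ∀ (p : ℕ) (E : Fin p → Type u) [∀ i, NormedAddCommGroup (E i)] [∀ i, NormedSpace ℝ (E i)]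
    [∀ i, CompleteSpace (E i)] (G : GeneralizedNashGame E),
    G.HasAdmissibleStrategySets →
    (∀ i, Continuous (G.θ i) ∧ G.QuasiConcaveInOwnVariable i) →
    (∀ i, G.HasAdmissibleConstraint i) →
    ∃ x : G.Profile, G.IsGeneralizedNashEquilibrium x

/-- The assertion of the Morgan–Scalzo theorem for generalized Nash games on Banach spaces: as in
the Arrow–Debreu theorem, with pseudo-continuous payoffs. -/
def MorganScalzoGeneralizedNashTheorem : Prop :=
  ∀ (p : ℕ) (E : Fin p → Type u) [∀ i, NormedAddCommGroup (E i)] [∀ i, NormedSpace ℝ (E i)]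
    [∀ i, CompleteSpace (E i)] (G : GeneralizedNashGame E),
    G.HasAdmissibleStrategySets →
    (∀ i, PseudoContinuous (G.θ i) ∧ G.QuasiConcaveInOwnVariable i) →
    (∀ i, G.HasAdmissibleConstraint i) →
    ∃ x : G.Profile, G.IsGeneralizedNashEquilibrium x

/-! Debreu's theorem already yields fixed points. A two-player game with payoffs minus distance
gives Schauder's theorem, and continuous approximate selections of a correspondence upgrade it to
Kakutani's theorem for compact convex sets in Banach spaces. Applied to the product of the
constrained best-reply correspondences, this gives a generalized Nash equilibrium. Pseudo-continuity
suffices for the best replies to exist and to have a closed graph. On a connected space, such as a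
product of convex sets, a strict inequality `f a < f b` admits an intermediate value of `f`, so it
persists when both points move. Hence (D) implies (MS'), and the other implications are
specializations. -/

open Set Filter

section PseudoContinuityLemmas

variable {X Y : Type*} [TopologicalSpace X] [TopologicalSpace Y]

theorem UpperPseudoContinuous.comp {f : X → ℝ} (hf : UpperPseudoContinuous f) {g : Y → X}
    (hg : Continuous g) : UpperPseudoContinuous (f ∘ g) :=
  fun x y hxy => hg.continuousAt.eventually (hf (g x) (g y) hxy)

theorem PseudoContinuous.comp {f : X → ℝ} (hf : PseudoContinuous f) {g : Y → X}
    (hg : Continuous g) : PseudoContinuous (f ∘ g) :=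
  ⟨hf.1.comp hg, UpperPseudoContinuous.comp hf.2 hg⟩

theorem Continuous.upperPseudoContinuous {f : X → ℝ} (hf : Continuous f) :
    UpperPseudoContinuous f :=
  fun _ _ hxy => hf.continuousAt.eventually_lt continuousAt_const hxy

theorem Continuous.pseudoContinuous {f : X → ℝ} (hf : Continuous f) : PseudoContinuous f :=
  ⟨hf.upperPseudoContinuous, hf.neg.upperPseudoContinuous⟩

theorem PseudoContinuous.eventually_lt {f : X → ℝ} (hf : PseudoContinuous f) {x y : X}
    (h : f x < f y) : ∀ᶠ x' in 𝓝 x, f x' < f y :=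
  hf.1 x y h

theorem PseudoContinuous.eventually_gt {f : X → ℝ} (hf : PseudoContinuous f) {x y : X}
    (h : f x < f y) : ∀ᶠ y' in 𝓝 y, f x < f y' :=
  (hf.2 y x (neg_lt_neg h)).mono fun _ h => neg_lt_neg_iff.1 h

/-- The range of a pseudo-continuous function on a preconnected space is densely ordered. -/
theorem PseudoContinuous.exists_between [PreconnectedSpace X] {f : X → ℝ}
    (hf : PseudoContinuous f) {x y : X} (h : f x < f y) : ∃ z, f x < f z ∧ f z < f y := by
  by_contra! hne
  -- With no value in between, these two open sets would be disjoint, non-empty and cover the space.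
  have h₁ : IsOpen {z | f z < f y} := isOpen_iff_mem_nhds.2 fun _ hz => hf.eventually_lt hz
  have h₂ : IsOpen {z | f x < f z} := isOpen_iff_mem_nhds.2 fun _ hz => hf.eventually_gt hz
  obtain ⟨z, -, hz₁, hz₂⟩ := isPreconnected_univ _ _ h₁ h₂
    (fun z _ => (le_or_gt (f y) (f z)).elim (fun hz => Or.inr (h.trans_le hz)) Or.inl)
    ⟨x, mem_univ x, h⟩ ⟨y, mem_univ y, h⟩
  exact (hne z hz₂).not_gt hz₁

/-- If `f a < f b` and `f` is pseudo-continuous on a preconnected space, then the inequality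
persists for all pairs of points near `a` and `b`. -/
theorem PseudoContinuous.eventually_lt_prod [PreconnectedSpace X] {f : X → ℝ}
    (hf : PseudoContinuous f) {a b : X} (h : f a < f b) :
    ∃ U ∈ 𝓝 a, ∃ V ∈ 𝓝 b, ∀ u ∈ U, ∀ v ∈ V, f u < f v := by
  obtain ⟨z, haz, hzb⟩ := hf.exists_between h
  exact ⟨_, hf.eventually_lt haz, _, hf.eventually_gt hzb, fun _ hu _ hv => lt_trans hu hv⟩

/-- Without a maximum each `x` is beaten by some `g x`, and finitely many sets `{f < f (g x)}` cover
`s`. The best of the corresponding `g x` lies in none of them. -/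
theorem UpperPseudoContinuous.exists_isMaxOn {f : X → ℝ} (hf : UpperPseudoContinuous f)
    {s : Set X} (hs : IsCompact s) (hne : s.Nonempty) : ∃ x ∈ s, IsMaxOn f s x := by
  by_contra! hcon
  have hlt : ∀ x ∈ s, ∃ y ∈ s, f x < f y := by
    intro x hx
    simpa [isMaxOn_iff] using hcon x hx
  choose! g hgs hg using hlt
  obtain ⟨t, hts, ht⟩ := hs.elim_nhds_subcover (fun x => {x' | f x' < f (g x)})
    fun x hx => hf x (g x) (hg x hx)
  have htne : t.Nonempty := by
    obtain ⟨x, hx⟩ := hne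
    obtain ⟨i, hi, -⟩ := mem_iUnion₂.1 (ht hx)
    exact ⟨i, hi⟩
  obtain ⟨m, hm, hmax⟩ := t.exists_max_image (fun x => f (g x)) htne
  obtain ⟨i, hi, hlt⟩ := mem_iUnion₂.1 (ht (hgs m (hts m hm)))
  exact (hmax i hi).not_gt hlt

theorem UpperHemicontinuous.isClosed_graph [RegularSpace Y] {K : X → Set Y}
    (hK : UpperHemicontinuous K) (hcl : ∀ x, IsClosed (K x)) :
    IsClosed {q : X × Y | q.2 ∈ K q.1} := by
  refine isOpen_compl_iff.1 (isOpen_iff_mem_nhds.2 ?_)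
  rintro ⟨x, y⟩ hxy
  obtain ⟨u, hu, v, hv, huv⟩ :=
    Filter.disjoint_iff.1 (RegularSpace.regular (hcl x) (show y ∉ K x from hxy))
  filter_upwards [prod_mem_nhds (hK x u hu) hv] with q hq hmem
  exact disjoint_left.1 huv (subset_of_mem_nhdsSet hq.1 hmem) hq.2

/-- The graph of the correspondence of constrained maximizers of a pseudo-continuous function is
closed. -/
theorem PseudoContinuous.isClosed_graph_argmax [PreconnectedSpace (X × Y)] {f : X × Y → ℝ}
    (hf : PseudoContinuous f) {K : X → Set Y} (hK : LowerHemicontinuous K)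
    (hgr : IsClosed {q : X × Y | q.2 ∈ K q.1}) :
    IsClosed {q : X × Y | q.2 ∈ K q.1 ∧ ∀ t ∈ K q.1, f (q.1, t) ≤ f q} := by
  refine isOpen_compl_iff.1 (isOpen_iff_mem_nhds.2 ?_)
  rintro ⟨x, y⟩ hxy
  by_cases hy : y ∈ K x
  · have : ∃ t ∈ K x, f (x, y) < f (x, t) := by
      -- A feasible `y` outside the argmax is beaten by some `t ∈ K x`. Lower hemicontinuity
      -- supplies feasible points near `t` for all nearby parameters, and they still beat all points
      -- near `y`.
      by_contra! hcon
      exact hxy ⟨hy, hcon⟩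
    obtain ⟨t, ht, hlt⟩ := this
    obtain ⟨U, hU, V, hV, hUV⟩ := hf.eventually_lt_prod hlt
    obtain ⟨A, hA, B, hB, hAB⟩ := mem_nhds_prod_iff.1 hV
    obtain ⟨O, hOB, hO, htO⟩ := mem_nhds_iff.1 hB
    have hev := (lowerHemicontinuous_iff.1 hK x : LowerHemicontinuousAt K x)
    have hev := lowerHemicontinuousAt_iff.1 hev O hO ⟨t, ht, htO⟩
    filter_upwards [hU, prod_mem_nhds (inter_mem hA hev) univ_mem] with q hqU hq hmem
    obtain ⟨s, hsK, hsO⟩ := hq.1.2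
    exact (hmem.2 s hsK).not_gt (hUV q hqU _ (hAB ⟨hq.1.1, hOB hsO⟩))
  · filter_upwards [hgr.isOpen_compl.mem_nhds (show (x, y) ∈ {q : X × Y | q.2 ∈ K q.1}ᶜ from hy)]
      with q hq hmem
    exact hq hmem.1

end PseudoContinuityLemmas

section FixedPoints

variable {V : Type u} [NormedAddCommGroup V] [NormedSpace ℝ V]

/-- Schauder's fixed point theorem follows from Debreu's theorem: in a two-player game, the first
player imitates the second one, and the second player aims at the image of the first one. -/
theorem DebreuTheorem.exists_fixedPoint (hD : DebreuTheorem.{u}) [CompleteSpace V] {C : Set V}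
    (hc : IsCompact C) (hconv : Convex ℝ C) (hne : C.Nonempty) {g : C → C} (hg : Continuous g) :
    ∃ x, g x = x := by
  let G : NashGame (fun _ : Fin 2 => V) :=
    { C := fun _ => C
      θ := fun i x => if i = 0 then -dist (x 0 : V) (x 1) else -dist (x 1 : V) (g (x 0)) }
  have hconc : ∀ (a : V) (r : ℝ), Convex ℝ {t : V | ∃ _ : t ∈ C, r ≤ -dist t a} := by
    intro a r
    convert hconv.inter (convex_closedBall a (-r)) using 1
    ext t
    simp only [mem_ofPred_eq, mem_inter_iff, Metric.mem_closedBall, exists_prop, le_neg]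
  obtain ⟨x, hx⟩ := hD 2 (fun _ => V) G (fun _ => ⟨hc, hconv, hne⟩) (by
    intro i
    fin_cases i
    · refine ⟨?_, fun x r => ?_⟩
      · change Continuous fun x : Fin 2 → C => -dist (x 0 : V) (x 1)
        fun_prop
      · simpa [G] using hconc (x 1) r
    · refine ⟨?_, fun x r => ?_⟩
      · change Continuous fun x : Fin 2 → C => -dist (x 1 : V) (g (x 0))
        fun_prop
      · simpa [G] using hconc (g (x 0)) r)
  have h₀ : -dist (x 1 : V) (x 1) ≤ -dist (x 0 : V) (x 1) := by
    simpa [G] using hx 0 (x 1)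
  have h₁ : -dist (g (x 0) : V) (g (x 0)) ≤ -dist (x 1 : V) (g (x 0)) := by
    simpa [G] using hx 1 (g (x 0))
  have e₀ : x 0 = x 1 := Subtype.ext (dist_le_zero.1 (by simpa using h₀))
  have e₁ : x 1 = g (x 0) := Subtype.ext (dist_le_zero.1 (by simpa using h₁))
  exact ⟨x 0, e₁.symm.trans e₀.symm⟩

/-- A correspondence with closed graph and values in a compact set is upper hemicontinuous. -/
theorem eventually_subset_of_isClosed_graph {X Y : Type*} [TopologicalSpace X]
    [TopologicalSpace Y] {C : Set Y} (hc : IsCompact C) {Φ : X → Set Y} (hΦC : ∀ x, Φ x ⊆ C)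
    (hgr : IsClosed {q : X × Y | q.2 ∈ Φ q.1}) {x : X} {U : Set Y} (hU : IsOpen U)
    (hx : Φ x ⊆ U) : ∀ᶠ z in 𝓝 x, Φ z ⊆ U := by
  have := isCompact_iff_compactSpace.1 hc
  -- The bad parameters are the projection of this closed set along a compact factor, hence a closed
  -- set.
  have hA : IsClosed {q : X × C | (q.2 : Y) ∈ Φ q.1 ∧ (q.2 : Y) ∉ U} :=
    (hgr.preimage (f := fun q : X × C => (q.1, (q.2 : Y))) (by fun_prop)).inter
      (hU.isClosed_compl.preimage (f := fun q : X × C => (q.2 : Y)) (by fun_prop))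
  have hx' : x ∉ Prod.fst '' {q : X × C | (q.2 : Y) ∈ Φ q.1 ∧ (q.2 : Y) ∉ U} := by
    rintro ⟨q, hq, rfl⟩
    exact hq.2 (hx hq.1)
  filter_upwards [(isClosedMap_fst_of_compactSpace _ hA).isOpen_compl.mem_nhds hx'] with z hz y hy
  by_contra hyU
  exact hz ⟨(z, ⟨y, hΦC z hy⟩), ⟨hy, hyU⟩, rfl⟩

/-- The fixed point theorem of Kakutani, Bohnenblust and Karlin follows from Debreu's theorem. -/
theorem DebreuTheorem.exists_mem_correspondence (hD : DebreuTheorem.{u}) [CompleteSpace V]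
    {C : Set V} (hc : IsCompact C) (hconv : Convex ℝ C) (hne : C.Nonempty) {Φ : C → Set V}
    (hΦC : ∀ x, Φ x ⊆ C) (hΦconv : ∀ x, Convex ℝ (Φ x)) (hΦne : ∀ x, (Φ x).Nonempty)
    (hgr : IsClosed {q : C × V | q.2 ∈ Φ q.1}) : ∃ x : C, (x : V) ∈ Φ x := by
  have := isCompact_iff_compactSpace.1 hc
  have approx : ∀ ε : ℝ, 0 < ε →
      ∃ x : C, (x : V) ∈ convexHull ℝ (⋃ z ∈ Metric.ball x ε, Φ z) := by
    intro ε hε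
    -- A fixed `c ∈ Φ x` lies in the hull attached to every `y` within `ε` of `x`; such local
    -- constants glue by a partition of unity.
    obtain ⟨g, hg⟩ := exists_continuous_forall_mem_convex_of_local_const
      (t := fun x : C => convexHull ℝ (⋃ z ∈ Metric.ball x ε, Φ z))
      (fun x => convex_convexHull ℝ _) (fun x => by
        obtain ⟨c, hcx⟩ := hΦne x
        refine ⟨c, ?_⟩
        filter_upwards [Metric.ball_mem_nhds x hε] with y hy
        exact subset_convexHull ℝ _ (mem_biUnion (Metric.mem_ball'.2 hy) hcx))
    have hgC : ∀ x, g x ∈ C := fun x =>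
      convexHull_min (iUnion₂_subset fun z _ => hΦC z) hconv (hg x)
    obtain ⟨x, hx⟩ := hD.exists_fixedPoint hc hconv hne (g := fun x => ⟨g x, hgC x⟩)
      (g.continuous.subtype_mk _)
    refine ⟨x, ?_⟩
    have := hg x
    rwa [show g x = (x : V) from congrArg Subtype.val hx] at this
  choose x hx using fun n : ℕ => approx (1 / ((n : ℝ) + 1)) Nat.one_div_pos_of_nat
  obtain ⟨a, φ, hφ, hlim⟩ := CompactSpace.tendsto_subseq x
  refine ⟨a, ?_⟩
  have hcl : IsClosed (Φ a) := hgr.preimage (f := fun y : V => (a, y)) (by fun_prop)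
  have hlim' : Tendsto (fun n => (x (φ n) : V)) atTop (𝓝 a) :=
    (continuous_subtype_val.tendsto a).comp hlim
  rw [hcl.mem_iff_infDist_zero (hΦne a)]
  refine le_antisymm (le_of_forall_pos_le_add fun δ hδ => ?_) Metric.infDist_nonneg
  rw [zero_add]
  have hev := eventually_subset_of_isClosed_graph hc hΦC hgr
    (Metric.isOpen_thickening (δ := δ) (E := Φ a)) (Metric.self_subset_thickening hδ _)
  obtain ⟨r, hr, hball⟩ := Metric.eventually_nhds_iff.1 hev
  have hsmall : ∀ᶠ n in atTop, 1 / (((φ n : ℕ) : ℝ) + 1) < r / 2 :=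
    (tendsto_one_div_add_atTop_nhds_zero_nat.comp hφ.tendsto_atTop).eventually_lt_const (half_pos hr)
  refine le_of_tendsto ((Metric.continuous_infDist_pt (Φ a)).tendsto _ |>.comp hlim') ?_
  filter_upwards [hsmall, Metric.tendsto_nhds.1 hlim _ (half_pos hr)] with n hn₁ hn₂
  -- For large `n` the ball around `x (φ n)` lies within `r` of `a`, so its values lie in the
  -- thickening of `Φ a`. That thickening is convex, so it contains their hull too.
  have hmem : (x (φ n) : V) ∈ Metric.thickening δ (Φ a) := by
    refine convexHull_min (iUnion₂_subset fun z hz => hball ?_) ((hΦconv a).thickening δ)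
      (hx (φ n))
    have h₁ : dist z (x (φ n)) < r / 2 := (Metric.mem_ball.1 hz).trans hn₁
    have h₂ : dist (x (φ n)) a < r / 2 := hn₂
    linarith [dist_triangle z (x (φ n)) a]
  obtain ⟨b, hb, hdist⟩ := Metric.mem_thickening_iff.1 hmem
  exact (Metric.infDist_le_dist_of_mem hb).trans hdist.le

end FixedPoints

theorem DebreuTheorem.morganScalzoGeneralizedNashTheorem (hD : DebreuTheorem.{u}) :
    MorganScalzoGeneralizedNashTheorem.{u} := by
  intro p E _ _ _ G hC hθ hK
  have hcompact : ∀ i, CompactSpace (G.C i) := fun i => isCompact_iff_compactSpace.1 (hC i).1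
  have hconn : ∀ i, PreconnectedSpace (G.C i) :=
    fun i => Subtype.preconnectedSpace (hC i).2.1.isPreconnected
  let f : (i : Fin p) → G.Profile × G.C i → ℝ :=
    fun i q => G.θ i (Function.update q.1 i q.2)
  have hf : ∀ i, PseudoContinuous (f i) := fun i =>
    (hθ i).1.comp (g := fun q : G.Profile × G.C i => Function.update q.1 i q.2)
      (continuous_fst.update i continuous_snd)
  let B : (i : Fin p) → G.Profile → Set (G.C i) := fun i x =>
    {t | t ∈ G.K i (G.rivals i x) ∧ ∀ s ∈ G.K i (G.rivals i x), f i (x, s) ≤ f i (x, t)}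
  have hriv : ∀ i, Continuous (G.rivals i) := fun i =>
    continuous_pi fun j => continuous_apply (j : Fin p)
  have hBgr : ∀ i, IsClosed {q : G.Profile × G.C i | q.2 ∈ B i q.1} := by
    intro i
    refine (hf i).isClosed_graph_argmax (K := fun x => G.K i (G.rivals i x)) ?_ ?_
    · exact (hK i).1.comp (hriv i)
    · exact ((hK i).2.1.isClosed_graph fun y => ((hK i).2.2 y).2.1).preimage
        (f := fun q : G.Profile × G.C i => (G.rivals i q.1, q.2))
        (((hriv i).comp continuous_fst).prodMk continuous_snd)
  have hBne : ∀ i x, (B i x).Nonempty := by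
    intro i x
    obtain ⟨t, ht, hmax⟩ := ((hf i).1.comp (g := fun t : G.C i => (x, t))
      (by fun_prop)).exists_isMaxOn ((hK i).2.2 (G.rivals i x)).2.1.isCompact
      ((hK i).2.2 (G.rivals i x)).2.2
    exact ⟨t, ht, fun s hs => hmax hs⟩
  have hBconv : ∀ i x, Convex ℝ (Subtype.val '' B i x) := by
    intro i x
    obtain ⟨m, hm⟩ := hBne i x
    -- Best replies are the feasible points in the upper level set at the maximal value.
    convert ((hK i).2.2 (G.rivals i x)).1.inter ((hθ i).2 x (f i (x, m))) using 1
    ext t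
    constructor
    · rintro ⟨t, ht, rfl⟩
      exact ⟨⟨t, ht.1, rfl⟩, t.2, ht.2 m hm.1⟩
    · rintro ⟨⟨t, ht, rfl⟩, _, hle⟩
      exact ⟨t, ⟨ht, fun s hs => (hm.2 s hs).trans hle⟩, rfl⟩
  -- The fixed point theorem needs a single Banach space: the finite product of the `E i`.
  let S : Set (∀ i, E i) := Set.pi univ G.C
  let toProfile : S → G.Profile := fun x i => ⟨x.1 i, x.2 i (mem_univ i)⟩
  have htoProfile : Continuous toProfile :=
    continuous_pi fun i => ((continuous_apply i).comp continuous_subtype_val).subtype_mk _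
  obtain ⟨x, hx⟩ := hD.exists_mem_correspondence (C := S)
    (Φ := fun x => Set.pi univ fun i => Subtype.val '' B i (toProfile x))
    (isCompact_univ_pi fun i => (hC i).1) (convex_pi fun i _ => (hC i).2.1)
    (univ_pi_nonempty_iff.2 fun i => (hC i).2.2)
    (fun x y hy i _ => by
      obtain ⟨t, -, ht⟩ := hy i (mem_univ i)
      exact ht ▸ t.2)
    (fun x => convex_pi fun i _ => hBconv i _)
    (fun x => univ_pi_nonempty_iff.2 fun i => (hBne i _).image _)
    (by
      -- Since `C i` is closed in `E i`, the graph stays closed when viewed in the ambient space.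
      have hcl : ∀ i, IsClosed ((fun q : G.Profile × G.C i => (q.1, (q.2 : E i))) ''
          {q | q.2 ∈ B i q.1}) := fun i =>
        ((IsClosedEmbedding.id.prodMap (hC i).1.isClosed.isClosedEmbedding_subtypeVal).isClosedMap)
          _ (hBgr i)
      have hpre := isClosed_iInter fun i => (hcl i).preimage
        (f := fun q : S × (∀ i, E i) => (toProfile q.1, q.2 i))
        ((htoProfile.comp continuous_fst).prodMk ((continuous_apply i).comp continuous_snd))
      convert hpre using 1
      ext q
      simp only [mem_ofPred_eq, mem_univ_pi, mem_iInter, mem_preimage, mem_image, Prod.exists,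
        Prod.mk.injEq]
      refine forall_congr' fun i => ⟨?_, ?_⟩
      · rintro ⟨t, ht, he⟩
        exact ⟨_, t, ht, rfl, he⟩
      · rintro ⟨_, t, ht, rfl, he⟩
        exact ⟨t, ht, he⟩)
  refine ⟨toProfile x, fun i => ?_⟩
  obtain ⟨t, ht, he⟩ := hx i (mem_univ i)
  obtain rfl : t = toProfile x i := Subtype.ext he
  refine ⟨ht.1, fun s hs => ?_⟩
  simpa [f] using ht.2 s hs

theorem MorganScalzoGeneralizedNashTheorem.arrowDebreuTheorem
    (h : MorganScalzoGeneralizedNashTheorem.{u}) : ArrowDebreuTheorem.{u} :=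
  fun p E _ _ _ G hC hθ hK =>
    h p E G hC (fun i => ⟨(hθ i).1.pseudoContinuous, (hθ i).2⟩) hK

theorem MorganScalzoNashTheorem.debreuTheorem (h : MorganScalzoNashTheorem.{u}) :
    DebreuTheorem.{u} :=
  fun p E _ _ _ G hC hθ => h p E G hC fun i => ⟨(hθ i).1.pseudoContinuous, (hθ i).2⟩

/-- A Nash game, regarded as a generalized Nash game without constraints. -/
def NashGame.toGeneralized {p : ℕ} {E : Fin p → Type u} (G : NashGame E) :
    GeneralizedNashGame E :=
  { G with K := fun _ _ => univ }

theorem NashGame.hasAdmissibleConstraint_toGeneralized {p : ℕ} {E : Fin p → Type u}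
    [∀ i, NormedAddCommGroup (E i)] [∀ i, NormedSpace ℝ (E i)] {G : NashGame E}
    (hC : G.HasAdmissibleStrategySets) (i : Fin p) :
    G.toGeneralized.HasAdmissibleConstraint i := by
  refine ⟨LowerHemicontinuous.const, UpperHemicontinuous.const, fun y => ⟨?_, isClosed_univ, ?_⟩⟩
  · change Convex ℝ (Subtype.val '' (univ : Set (G.C i)))
    rw [image_univ, Subtype.range_coe]
    exact (hC i).2.1
  · obtain ⟨t, ht⟩ := (hC i).2.2
    exact ⟨⟨t, ht⟩, mem_univ _⟩

theorem NashGame.IsNashEquilibrium.of_toGeneralized {p : ℕ} {E : Fin p → Type u} {G : NashGame E}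
    {x : G.Profile} (hx : G.toGeneralized.IsGeneralizedNashEquilibrium x) :
    G.IsNashEquilibrium x :=
  fun i t => (hx i).2 t (mem_univ t)

theorem ArrowDebreuTheorem.debreuTheorem (h : ArrowDebreuTheorem.{u}) : DebreuTheorem.{u} :=
  fun p E _ _ _ G hC hθ =>
    (h p E G.toGeneralized hC hθ (NashGame.hasAdmissibleConstraint_toGeneralized hC)).imp
      fun _ hx => NashGame.IsNashEquilibrium.of_toGeneralized hx

theorem MorganScalzoGeneralizedNashTheorem.morganScalzoNashTheorem
    (h : MorganScalzoGeneralizedNashTheorem.{u}) : MorganScalzoNashTheorem.{u} :=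
  fun p E _ _ _ G hC hθ =>
    (h p E G.toGeneralized hC hθ (NashGame.hasAdmissibleConstraint_toGeneralized hC)).imp
      fun _ hx => NashGame.IsNashEquilibrium.of_toGeneralized hx

theorem theorem5p6 :
    (DebreuTheorem.{u} → ArrowDebreuTheorem.{u}) ∧
      List.TFAE [DebreuTheorem.{u}, ArrowDebreuTheorem.{u},
        MorganScalzoNashTheorem.{u}, MorganScalzoGeneralizedNashTheorem.{u}] := by
  refine ⟨fun h => h.morganScalzoGeneralizedNashTheorem.arrowDebreuTheorem, ?_⟩
  tfae_have 1 → 4 := DebreuTheorem.morganScalzoGeneralizedNashTheorem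
  tfae_have 4 → 2 := MorganScalzoGeneralizedNashTheorem.arrowDebreuTheorem
  tfae_have 2 → 1 := ArrowDebreuTheorem.debreuTheorem
  tfae_have 4 → 3 := MorganScalzoGeneralizedNashTheorem.morganScalzoNashTheorem
  tfae_have 3 → 1 := MorganScalzoNashTheorem.debreuTheorem
  tfae_finish
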